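/- For integers $n\ge 0$ let $(a;q)_n=\prod_{i=0}^{n-1}(1-aq^i)$, so $(a;q)_0=1$. For positive integers $L,s,k$ let $$H_{L,s,k}(q)=\frac{q^s(1-q^k)}{(q^s;q)_{L+1}}-\left(\frac{1}{(q^{s+1};q)_L}-1\right),$$ regarded as a formal power series in $q$. For positive integers $L\ge 3$ and $s$ put $$P_{L,s}=(s+1)(s+2)\cdots(s+L),$$ $$\gamma(L,s)=\bigl((s+1)+(s+2)+\cdots+(s+L)\bigr)\left(P_{L,s}^{(P_{L,s}^2-1)L+2}+\bigl((P_{L,s}^2-1)L-2\bigr)P_{L,s}\right),$$ and let $\Gamma(s)=\gamma(3s+2,s)$, which depends only on $s$. Theorem. For all positive integers $L,s,k$ with $L\ge 3$ and $k\ge s+1$, the coefficient of $q^N$ in $H_{L,s,k}(q)$ is positive for every integer $N\ge\Gamma(s)$. -/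

import Mathlib

open PowerSeries

/-- The `q`-Pochhammer symbol `(a;q)_n = (1 - a)(1 - a q) ⋯ (1 - a q^(n-1))`, with `(a;q)_0 = 1`. -/
def qPochhammer {R : Type*} [CommRing R] (a q : R) (n : ℕ) : R :=
  ∏ i ∈ Finset.range n, (1 - a * q ^ i)

/-- The denominators occurring below are invertible power series: for `a ≥ 1`, the series
`(q^a;q)_n` has constant term `1`. -/
theorem constantCoeff_qPochhammer_X_pow (a n : ℕ) (ha : 1 ≤ a) :
    constantCoeff (qPochhammer ((X : ℚ⟦X⟧) ^ a) X n) = 1 := by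
  have : a ≠ 0 := by omega
  simp [qPochhammer, map_prod, this]

/-- The formal power series `H_{L,s,k}(q) = q^s (1 - q^k) / (q^s;q)_{L+1} - (1 / (q^{s+1};q)_L - 1)`
in the variable `q = X`. -/
noncomputable def seriesH (L s k : ℕ) : ℚ⟦X⟧ :=
  X ^ s * (1 - X ^ k) * (qPochhammer ((X : ℚ⟦X⟧) ^ s) X (L + 1))⁻¹
    - ((qPochhammer ((X : ℚ⟦X⟧) ^ (s + 1)) X L)⁻¹ - 1)

/-- `P_{L,s} = (s+1)(s+2) ⋯ (s+L)`. -/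
def prodP (L s : ℕ) : ℕ := ∏ i ∈ Finset.Icc 1 L, (s + i)

/-- `γ(L,s) = ((s+1) + ⋯ + (s+L)) (P^((P^2-1)L+2) + ((P^2-1)L-2) P)`, where `P = P_{L,s}`.
The subtractions do not truncate for `L ≥ 3` and `s ≥ 1`, see `two_le_prodP_sq_sub_one_mul`. -/
def gammaLS (L s : ℕ) : ℕ :=
  (∑ i ∈ Finset.Icc 1 L, (s + i)) *
    (prodP L s ^ ((prodP L s ^ 2 - 1) * L + 2) + ((prodP L s ^ 2 - 1) * L - 2) * prodP L s)

theorem two_le_prodP_sq_sub_one_mul (L s : ℕ) (hL : 3 ≤ L) (hs : 1 ≤ s) :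
    1 ≤ prodP L s ^ 2 ∧ 2 ≤ (prodP L s ^ 2 - 1) * L := by
  have h : s + 1 ≤ prodP L s :=
    Finset.single_le_prod' (f := fun i => s + i) (fun i hi => by
      have := (Finset.mem_Icc.1 hi).1
      omega) (Finset.mem_Icc.2 ⟨le_refl 1, by omega⟩)
  have h4 : 2 ^ 2 ≤ prodP L s ^ 2 := Nat.pow_le_pow_left (by omega) 2
  have h3 : 3 ≤ prodP L s ^ 2 - 1 := by omega
  exact ⟨by omega, by nlinarith⟩

/-- `Γ(s) = γ(3s+2, s)`. -/
def GammaBound (s : ℕ) : ℕ := gammaLS (3 * s + 2) s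

/-! Over the common denominator, `H - 1` equals `(q^s(1-q^k) - (1-q^s)) / (q^s;q)_{L+1}`. The
denominator splits into the parts `s, …, s+3`, which with the numerator give `coreSeries`, and the
parts `s+4, …, s+L`, which give `partsSeries`.

Let `A`, `B`, `C` count partitions into parts `{s,s+2,s+3}`, `{s+1,s+2,s+3}`, `{s,…,s+3}`. The core
coefficient at `m` is `C(m-s) - C(m-s-k) - B(m)`. As `C` is increasing up to a bounded loss and `k ≥
s+1`, it is at least `A(m-s) - B(m)` minus a constant. This grows quadratically, since `A` has the
larger leading coefficient. So core coefficients are bounded below, and large from a threshold `T`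
on, uniformly in `k` (`neg_deficit_le_coeff_coreSeries`, `large_coeff_coreSeries`).

In the convolution with the remaining parts, the indices below `T` do bounded harm:
`coeff_partsSeries_le` bounds each of their weights by twice the total weight of the indices from
`T` on, whatever the set of parts, hence independently of `L`. -/

/-! ### Geometric series and nonnegative coefficients -/

/-- The geometric series `1 / (1 - X ^ v)`. -/
noncomputable def geomX (v : ℕ) : ℚ⟦X⟧ := (1 - X ^ v)⁻¹

theorem one_sub_mul_geomX {v : ℕ} (hv : 1 ≤ v) : (1 - X ^ v) * geomX v = 1 :=
  PowerSeries.mul_inv_cancel _ (by simp [show v ≠ 0 by omega])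

/-- The coefficients of the quotient of a power series by `1 - X ^ v` satisfy a recursion. -/
theorem coeff_eq_of_one_sub_X_pow_mul {v : ℕ} {f g : ℚ⟦X⟧} (h : (1 - X ^ v) * f = g) (n : ℕ) :
    coeff n f = coeff n g + if v ≤ n then coeff (n - v) f else 0 := by
  rw [← h, sub_mul, one_mul, map_sub, coeff_X_pow_mul']
  ring

/-- A power series with nonnegative coefficients. -/
def NonnegCoeff (f : ℚ⟦X⟧) : Prop := ∀ n, 0 ≤ coeff n f

namespace NonnegCoeff

theorem zero : NonnegCoeff 0 := fun n => by simp

theorem one : NonnegCoeff 1 := fun n => by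
  rw [coeff_one]; split_ifs <;> norm_num

theorem X_pow (v : ℕ) : NonnegCoeff (X ^ v) := fun n => by
  rw [coeff_X_pow]; split_ifs <;> norm_num

theorem add {f g : ℚ⟦X⟧} (hf : NonnegCoeff f) (hg : NonnegCoeff g) : NonnegCoeff (f + g) :=
  fun n => by rw [map_add]; exact add_nonneg (hf n) (hg n)

theorem mul {f g : ℚ⟦X⟧} (hf : NonnegCoeff f) (hg : NonnegCoeff g) : NonnegCoeff (f * g) :=
  fun n => by rw [coeff_mul]; exact Finset.sum_nonneg fun p _ => mul_nonneg (hf _) (hg _)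

theorem sum {ι : Type*} {s : Finset ι} {f : ι → ℚ⟦X⟧} (h : ∀ i ∈ s, NonnegCoeff (f i)) :
    NonnegCoeff (∑ i ∈ s, f i) :=
  fun n => by rw [map_sum]; exact Finset.sum_nonneg fun i hi => h i hi n

theorem prod {ι : Type*} {s : Finset ι} {f : ι → ℚ⟦X⟧} (h : ∀ i ∈ s, NonnegCoeff (f i)) :
    NonnegCoeff (∏ i ∈ s, f i) :=
  Finset.prod_induction _ _ (fun _ _ => mul) one h

end NonnegCoeff

theorem nonnegCoeff_geomX {v : ℕ} (hv : 1 ≤ v) : NonnegCoeff (geomX v) := by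
  intro n
  induction n using Nat.strong_induction_on with
  | _ n ih =>
    rw [coeff_eq_of_one_sub_X_pow_mul (one_sub_mul_geomX hv)]
    refine add_nonneg (NonnegCoeff.one n) ?_
    split_ifs with h
    · exact ih _ (by omega)
    · exact le_rfl

theorem coeff_geomX_one (n : ℕ) : coeff n (geomX 1) = 1 := by
  induction n with
  | zero => rw [coeff_eq_of_one_sub_X_pow_mul (one_sub_mul_geomX le_rfl)]; simp
  | succ n ih => rw [coeff_eq_of_one_sub_X_pow_mul (one_sub_mul_geomX le_rfl)]; simp [coeff_one, ih]

/-! ### Counting partitions into two or three part sizes -/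

theorem coeff_geomX_mul_geomX_one {a : ℕ} (ha : 1 ≤ a) (n : ℕ) :
    coeff n (geomX a * geomX 1) = ((n / a : ℕ) : ℚ) + 1 := by
  have h : (1 - X ^ a) * (geomX a * geomX 1) = geomX 1 := by
    rw [← mul_assoc, one_sub_mul_geomX ha, one_mul]
  induction n using Nat.strong_induction_on with
  | _ n ih =>
    rw [coeff_eq_of_one_sub_X_pow_mul h, coeff_geomX_one]
    split_ifs with hn
    · rw [ih _ (by omega), Nat.div_eq_sub_div (by omega) hn]
      push_cast
      ring
    · rw [Nat.div_eq_of_lt (by omega)]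
      norm_num

/-- Follows from `(1 - X^(a+1)) - X(1 - X^a) = 1 - X`; it reduces the count for `a, a+1` to a
difference of two floor functions. -/
theorem geomX_mul_geomX_succ {a : ℕ} (ha : 1 ≤ a) :
    geomX a * geomX (a + 1) = geomX a * geomX 1 - X * (geomX (a + 1) * geomX 1) := by
  have h1 := one_sub_mul_geomX ha
  have h2 := one_sub_mul_geomX (show 1 ≤ a + 1 by omega)
  have h3 := one_sub_mul_geomX le_rfl
  linear_combination (-geomX a * geomX (a + 1)) * h3 + geomX a * geomX 1 * h2
    - X * geomX (a + 1) * geomX 1 * h1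

/-- The number of representations of `n` by `a` and `a + 1` is `n / (a (a + 1))` up to `1`. -/
theorem abs_coeff_geomX_mul_geomX_succ_sub_le {a : ℕ} (ha : 1 ≤ a) (n : ℕ) :
    |coeff n (geomX a * geomX (a + 1)) - (n : ℚ) / (a * (a + 1))| ≤ 1 := by
  rw [geomX_mul_geomX_succ ha, map_sub, coeff_geomX_mul_geomX_one ha]
  have ha0 : (0 : ℚ) < a := by exact_mod_cast ha
  rcases n with _ | n
  · simp
  · rw [coeff_succ_X_mul, coeff_geomX_mul_geomX_one (by omega)]
    have e : ((n + 1 : ℕ) : ℚ) / (a * (a + 1)) = ((n : ℚ) + 1) / a - (n + 1) / (a + 1) := by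
      push_cast
      field_simp
      ring
    have l1 : (((n + 1) / a : ℕ) : ℚ) ≤ ((n : ℚ) + 1) / a := by
      simpa using (Nat.cast_div_le (α := ℚ) (m := n + 1) (n := a))
    have l2 : ((n : ℚ) + 1) / a ≤ ((n + 1) / a : ℕ) + 1 := by
      rw [div_le_iff₀ ha0]
      have h : n + 1 ≤ ((n + 1) / a + 1) * a := by linarith [Nat.lt_mul_div_succ (n + 1) ha]
      exact_mod_cast h
    have l3 : ((n / (a + 1) : ℕ) : ℚ) + 1 / (a + 1) ≤ ((n : ℚ) + 1) / (a + 1) := by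
      have := (Nat.cast_div_le (α := ℚ) (m := n) (n := a + 1))
      push_cast at this
      rw [add_div]
      linarith
    have l4 : ((n : ℚ) + 1) / (a + 1) ≤ (n / (a + 1) : ℕ) + 1 := by
      rw [div_le_iff₀ (by positivity)]
      have := Nat.lt_mul_div_succ n (show 0 < a + 1 by omega)
      have h : n + 1 ≤ (n / (a + 1) + 1) * (a + 1) := by linarith
      exact_mod_cast h
    have l5 : (0 : ℚ) ≤ 1 / (a + 1) := by positivity
    rw [e, abs_le]
    constructor <;> linarith

/-- Upper bound for the number of representations by `w`, `a` and `a + 1`. -/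
theorem coeff_geomX_mul_le {a w : ℕ} (ha : 1 ≤ a) (hw : 1 ≤ w) (n : ℕ) :
    coeff n (geomX w * (geomX a * geomX (a + 1))) ≤
      ((n : ℚ) ^ 2 / (2 * w) + n / 2 + w / 2) / (a * (a + 1)) + n / w + 1 := by
  have h : (1 - X ^ w) * (geomX w * (geomX a * geomX (a + 1))) = geomX a * geomX (a + 1) := by
    rw [← mul_assoc, one_sub_mul_geomX hw, one_mul]
  have ha0 : (0 : ℚ) < a := by exact_mod_cast ha
  have hw0 : (0 : ℚ) < w := by exact_mod_cast hw
  induction n using Nat.strong_induction_on with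
  | _ n ih =>
    rw [coeff_eq_of_one_sub_X_pow_mul h]
    have he := (abs_le.1 (abs_coeff_geomX_mul_geomX_succ_sub_le ha n)).2
    split_ifs with hn
    · have := ih (n - w) (by omega)
      rw [Nat.cast_sub hn] at this
      -- The quadratic is chosen so that its increment over a step `w` is exactly `n/(a(a+1)) + 1`,
      -- the two-part upper bound.
      have e : ((((n : ℚ) - w) ^ 2 / (2 * w) + (n - w) / 2 + w / 2) / (a * (a + 1)) + (n - w) / w + 1)
          = ((n : ℚ) ^ 2 / (2 * w) + n / 2 + w / 2) / (a * (a + 1)) + n / w + 1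
            - (n : ℚ) / (a * (a + 1)) - 1 := by
        field_simp
        ring
      linarith
    · have e : (n : ℚ) ≤ (n : ℚ) ^ 2 / (2 * w) + n / 2 + w / 2 := by
        have : (n : ℚ) ^ 2 / (2 * w) + n / 2 + w / 2 - n = ((n - w / 2) ^ 2 + 3 / 4 * w ^ 2) / (2 * w) := by
          field_simp
          ring
        have : 0 ≤ ((n - w / 2 : ℚ) ^ 2 + 3 / 4 * w ^ 2) / (2 * w) := by positivity
        linarith
      have e2 : (n : ℚ) / (a * (a + 1)) ≤ ((n : ℚ) ^ 2 / (2 * w) + n / 2 + w / 2) / (a * (a + 1)) := by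
        gcongr
      have : (0 : ℚ) ≤ n / w := by positivity
      linarith

/-- Lower bound for the number of representations by `w`, `a` and `a + 1`. -/
theorem le_coeff_geomX_mul {a w : ℕ} (ha : 1 ≤ a) (hw : 1 ≤ w) (n : ℕ) :
    (n : ℚ) ^ 2 / (2 * w) / (a * (a + 1)) - n / w - 1 ≤
      coeff n (geomX w * (geomX a * geomX (a + 1))) := by
  have h : (1 - X ^ w) * (geomX w * (geomX a * geomX (a + 1))) = geomX a * geomX (a + 1) := by
    rw [← mul_assoc, one_sub_mul_geomX hw, one_mul]
  have ha0 : (0 : ℚ) < a := by exact_mod_cast ha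
  have hw0 : (0 : ℚ) < w := by exact_mod_cast hw
  induction n using Nat.strong_induction_on with
  | _ n ih =>
    rw [coeff_eq_of_one_sub_X_pow_mul h]
    have he := (abs_le.1 (abs_coeff_geomX_mul_geomX_succ_sub_le ha n)).1
    split_ifs with hn
    · have := ih (n - w) (by omega)
      rw [Nat.cast_sub hn] at this
      have e : ((n : ℚ) - w) ^ 2 / (2 * w) / (a * (a + 1)) - (n - w) / w - 1
          = (n : ℚ) ^ 2 / (2 * w) / (a * (a + 1)) - n / w - 1
            - (n : ℚ) / (a * (a + 1)) + 1 + w / 2 / (a * (a + 1)) := by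
        field_simp
        ring
      have : (0 : ℚ) ≤ w / 2 / (a * (a + 1)) := by positivity
      linarith
    · have hn' : (n : ℚ) ≤ w := by exact_mod_cast (by omega : n ≤ w)
      have e : (n : ℚ) ^ 2 / (2 * w) ≤ n := by
        rw [div_le_iff₀ (by positivity)]
        nlinarith [(Nat.cast_nonneg n : (0 : ℚ) ≤ n)]
      have e2 : (n : ℚ) ^ 2 / (2 * w) / (a * (a + 1)) ≤ n / (a * (a + 1)) := by
        gcongr
      have : (0 : ℚ) ≤ n / w := by positivity
      linarith

/-! ### Growth of partition counts for an arbitrary set of parts -/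

/-- The truncation `1 + X ^ v + ⋯ + X ^ (v (t - 1))` of the geometric series. -/
noncomputable def geomXTrunc (t v : ℕ) : ℚ⟦X⟧ := ∑ i ∈ Finset.range t, (X ^ v) ^ i

theorem geomX_eq_trunc_add {v : ℕ} (hv : 1 ≤ v) (t : ℕ) :
    geomX v = geomXTrunc t v + X ^ (v * t) * geomX v := by
  have h := one_sub_mul_geomX hv
  have h2 : geomXTrunc t v * (1 - X ^ v) = 1 - X ^ (v * t) := by
    rw [geomXTrunc, geom_sum_mul_neg, pow_mul]
  linear_combination geomXTrunc t v * h - geomX v * h2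

theorem nonnegCoeff_geomXTrunc (t v : ℕ) : NonnegCoeff (geomXTrunc t v) :=
  NonnegCoeff.sum fun i _ => by rw [← pow_mul]; exact NonnegCoeff.X_pow _

/-- The generating function of the partitions with parts in `S`. -/
noncomputable def partsSeries (S : Finset ℕ) : ℚ⟦X⟧ := ∏ v ∈ S, geomX v

theorem nonnegCoeff_partsSeries {S : Finset ℕ} (hS : ∀ v ∈ S, 1 ≤ v) :
    NonnegCoeff (partsSeries S) :=
  NonnegCoeff.prod fun v hv => nonnegCoeff_geomX (hS v hv)

/-- A partition with parts in `S` either uses each `v ∈ S` fewer than `t v` times, or it arises by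
adding `t v` copies of `v` to a partition for some `v ∈ S`. -/
theorem nonnegCoeff_trunc_add_sub_partsSeries {S : Finset ℕ} (hS : ∀ v ∈ S, 1 ≤ v) (t : ℕ → ℕ) :
    NonnegCoeff (∏ v ∈ S, geomXTrunc (t v) v + ∑ v ∈ S, X ^ (v * t v) * partsSeries S
      - partsSeries S) := by
  induction S using Finset.induction_on with
  | empty => simpa [partsSeries] using NonnegCoeff.zero
  | insert v S hv ih =>
    have hv1 := hS v (Finset.mem_insert_self v S)
    have hS' : ∀ u ∈ S, 1 ≤ u := fun u hu => hS u (Finset.mem_insert_of_mem hu)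
    have hF := geomX_eq_trunc_add hv1 (t v)
    have e : partsSeries (insert v S) = geomX v * partsSeries S := Finset.prod_insert hv
    rw [Finset.prod_insert hv, Finset.sum_insert hv, e, ← Finset.sum_mul]
    have i1 := (nonnegCoeff_geomXTrunc (t v) v).mul (ih hS')
    -- The overcount: partitions with `t v` copies of `v` and also `t u` copies of some `u ∈ S`.
    have i2 : NonnegCoeff ((X ^ (v * t v) * geomX v) *
        ((∑ u ∈ S, X ^ (u * t u)) * partsSeries S)) :=
      ((NonnegCoeff.X_pow _).mul (nonnegCoeff_geomX hv1)).mul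
        ((NonnegCoeff.sum fun u _ => NonnegCoeff.X_pow _).mul (nonnegCoeff_partsSeries hS'))
    convert i1.add i2 using 1
    rw [← Finset.sum_mul]
    linear_combination (∑ u ∈ S, X ^ (u * t u) - 1) * partsSeries S * hF

theorem coeff_prod_eq_zero {ι : Type*} {S : Finset ι} {f : ι → ℚ⟦X⟧} {d : ι → ℕ}
    (h : ∀ i ∈ S, ∀ n, d i < n → coeff n (f i) = 0) :
    ∀ n, ∑ i ∈ S, d i < n → coeff n (∏ i ∈ S, f i) = 0 := by
  classical
  induction S using Finset.induction_on with
  | empty =>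
    intro n hn
    rw [Finset.prod_empty, coeff_one, if_neg (by simp at hn; omega)]
  | insert v S hv ih =>
    intro n hn
    rw [Finset.sum_insert hv] at hn
    rw [Finset.prod_insert hv, coeff_mul]
    refine Finset.sum_eq_zero fun p hp => ?_
    rw [Finset.HasAntidiagonal.mem_antidiagonal] at hp
    by_cases h1 : d v < p.1
    · rw [h v (Finset.mem_insert_self v S) _ h1, zero_mul]
    · rw [ih (fun i hi => h i (Finset.mem_insert_of_mem hi)) p.2 (by omega), mul_zero]

theorem coeff_geomXTrunc_eq_zero {t v n : ℕ} (h : v * (t - 1) < n) :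
    coeff n (geomXTrunc t v) = 0 := by
  rw [geomXTrunc, map_sum]
  refine Finset.sum_eq_zero fun i hi => ?_
  rw [Finset.mem_range] at hi
  have : v * i ≤ v * (t - 1) := Nat.mul_le_mul_left _ (by omega)
  rw [← pow_mul, coeff_X_pow, if_neg (by omega)]

/-- Injectivity of `c` makes the indices `n - c v` distinct, so the sum uses each earlier
coefficient at most once. -/
theorem sum_coeff_X_pow_mul_le {S : Finset ℕ} {f : ℚ⟦X⟧} (hf : NonnegCoeff f) {c : ℕ → ℕ}
    (hc : Set.InjOn c S) {t : ℕ} (ht : ∀ v ∈ S, t ≤ c v) (n : ℕ) (hn : t ≤ n) :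
    ∑ v ∈ S, coeff n (X ^ c v * f) ≤ ∑ i ∈ Finset.range (n - t + 1), coeff i f := by
  simp_rw [coeff_X_pow_mul']
  rw [← Finset.sum_filter]
  have hinj : Set.InjOn (fun v => n - c v) (S.filter fun v => c v ≤ n) := by
    intro u hu v hv huv
    simp only [Finset.coe_filter, Set.mem_ofPred_eq] at hu hv huv
    exact hc hu.1 hv.1 (by omega)
  rw [← Finset.sum_image (f := fun i => coeff i f) hinj]
  refine Finset.sum_le_sum_of_subset_of_nonneg (fun i hi => ?_) (fun _ _ _ => hf _)
  obtain ⟨v, hv, rfl⟩ := Finset.mem_image.1 hi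
  have := ht v (Finset.mem_filter.1 hv).1
  rw [Finset.mem_range]
  omega

/-- For `n` large, the coefficient at `n` is controlled by the earlier ones: a partition of `n` has
a part `≥ t`, or `t` copies of a part `< t`. -/
theorem coeff_partsSeries_le {S : Finset ℕ} (hS : ∀ v ∈ S, 1 ≤ v) {t n : ℕ} (ht : 1 ≤ t)
    (hn : t ^ 3 ≤ n) :
    coeff n (partsSeries S) ≤ 2 * ∑ i ∈ Finset.range (n - t + 1), coeff i (partsSeries S) := by
  have hpos := nonnegCoeff_partsSeries hS
  have htn : t ≤ n := (Nat.le_self_pow (by norm_num) t).trans hn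
  have h := nonnegCoeff_trunc_add_sub_partsSeries hS (fun v => if t ≤ v then 1 else t) n
  -- With parts `≥ t` forbidden and smaller ones used fewer than `t` times, the total is at most `t
  -- · t(t-1) < t^3`.
  have h0 : coeff n (∏ v ∈ S, geomXTrunc (if t ≤ v then 1 else t) v) = 0 := by
    refine coeff_prod_eq_zero (d := fun v => if t ≤ v then 0 else v * (t - 1)) (fun v hv m hm => ?_)
      n ?_
    · refine coeff_geomXTrunc_eq_zero (lt_of_eq_of_lt ?_ hm)
      split_ifs <;> simp
    · have h1 : ∑ v ∈ S, (if t ≤ v then 0 else v * (t - 1)) ≤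
          ∑ v ∈ S.filter (fun v => v < t), t * (t - 1) := by
        rw [Finset.sum_filter]
        refine Finset.sum_le_sum fun v _ => ?_
        split_ifs
        · omega
        · omega
        · exact Nat.mul_le_mul_right _ (by omega)
        · omega
      have h2 : (S.filter (fun v => v < t)).card ≤ t := by
        have : S.filter (fun v => v < t) ⊆ Finset.range t := fun v hv => by
          simp at hv ⊢; exact hv.2
        simpa using Finset.card_le_card this
      rw [Finset.sum_const, smul_eq_mul] at h1
      have h3 : (S.filter (fun v => v < t)).card * (t * (t - 1)) ≤ t * (t * (t - 1)) :=
        Nat.mul_le_mul_right _ h2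
      have h4 : t * (t * (t - 1)) < t ^ 3 := by
        have : t * (t * (t - 1)) < t * (t * t) := by gcongr; omega
        linarith [this, (by ring : t * (t * t) = t ^ 3)]
      omega
  -- The removed amount is `v` for large parts and `vt` for small ones, injective on each class
  -- separately; hence the factor 2.
  rw [map_sub, map_add, h0, map_sum, ← Finset.sum_filter_add_sum_filter_not S (fun v => t ≤ v)] at h
  have h1 : ∑ v ∈ S with t ≤ v, coeff n (X ^ (v * if t ≤ v then 1 else t) * partsSeries S) ≤
      ∑ i ∈ Finset.range (n - t + 1), coeff i (partsSeries S) := by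
    refine sum_coeff_X_pow_mul_le hpos (c := fun v => v * if t ≤ v then 1 else t) ?_ ?_ n htn
    · intro u hu v hv huv
      simp only [Finset.coe_filter, Set.mem_ofPred_eq] at hu hv
      simpa [hu.2, hv.2] using huv
    · intro v hv
      simp only [Finset.mem_filter] at hv
      simp [hv.2]
  have h2 : ∑ v ∈ S with ¬ t ≤ v, coeff n (X ^ (v * if t ≤ v then 1 else t) * partsSeries S) ≤
      ∑ i ∈ Finset.range (n - t + 1), coeff i (partsSeries S) := by
    refine sum_coeff_X_pow_mul_le hpos (c := fun v => v * if t ≤ v then 1 else t) ?_ ?_ n htn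
    · intro u hu v hv huv
      simp only [Finset.coe_filter, Set.mem_ofPred_eq] at hu hv
      simp only [hu.2, hv.2, if_false] at huv
      exact Nat.eq_of_mul_eq_mul_right ht huv
    · intro v hv
      simp only [Finset.mem_filter] at hv
      simp only [hv.2, if_false]
      exact Nat.le_mul_of_pos_left t (hS v hv.1)
  linarith

/-! ### Difference estimates for the parts `s, …, s+3` -/

theorem neg_le_of_quadratic_le {x y K : ℚ} (hK : 0 < K) (h : y ^ 2 / K - 4 * y - 4 ≤ x) :
    -(4 * K + 4) ≤ x := by
  have : y ^ 2 / K - 4 * y - 4 = (y - 2 * K) ^ 2 / K - (4 * K + 4) := by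
    field_simp
    ring
  have : 0 ≤ (y - 2 * K) ^ 2 / K := by positivity
  linarith

/-- The coefficients of the series with parts `s, s+1, s+2, s+3` satisfy difference estimates of the
form `n ^ 2 / growthK s - O(n)`. -/
@[irreducible] def growthK (s : ℕ) : ℕ := 2 * (s + 3) ^ 4

/-- The generating function of the partitions with parts `s, s+2, s+3`. -/
noncomputable def seriesA (s : ℕ) : ℚ⟦X⟧ := geomX s * (geomX (s + 2) * geomX (s + 2 + 1))

/-- The generating function of the partitions with parts `s+1, s+2, s+3`. -/
noncomputable def seriesB (s : ℕ) : ℚ⟦X⟧ := geomX (s + 1) * (geomX (s + 2) * geomX (s + 2 + 1))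

/-- The generating function of the partitions with parts `s, s+1, s+2, s+3`. -/
noncomputable def seriesC (s : ℕ) : ℚ⟦X⟧ := geomX s * seriesB s

theorem nonnegCoeff_seriesB (s : ℕ) : NonnegCoeff (seriesB s) :=
  (nonnegCoeff_geomX (by omega)).mul
    ((nonnegCoeff_geomX (by omega)).mul (nonnegCoeff_geomX (by omega)))

theorem nonnegCoeff_seriesC {s : ℕ} (hs : 1 ≤ s) : NonnegCoeff (seriesC s) :=
  (nonnegCoeff_geomX hs).mul (nonnegCoeff_seriesB s)

theorem one_sub_mul_seriesC {s : ℕ} (hs : 1 ≤ s) : (1 - X ^ s) * seriesC s = seriesB s := by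
  rw [seriesC, ← mul_assoc, one_sub_mul_geomX hs, one_mul]

theorem one_sub_succ_mul_seriesC (s : ℕ) : (1 - X ^ (s + 1)) * seriesC s = seriesA s := by
  have h := one_sub_mul_geomX (show 1 ≤ s + 1 by omega)
  rw [seriesC, seriesB, seriesA]
  linear_combination geomX s * (geomX (s + 2) * geomX (s + 2 + 1)) * h

theorem coeff_seriesB_le {s : ℕ} (hs1 : 1 ≤ s) (n : ℕ) : coeff n (seriesB s) ≤
    (n : ℚ) ^ 2 / (2 * (s + 1) * ((s + 2) * (s + 3))) + n + 2 := by
  have h := coeff_geomX_mul_le (a := s + 2) (w := s + 1) (by omega) (by omega) n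
  refine h.trans ?_
  push_cast
  have e : ((n : ℚ) ^ 2 / (2 * (s + 1)) + n / 2 + (s + 1) / 2) / ((s + 2) * (s + 2 + 1)) =
      (n : ℚ) ^ 2 / (2 * (s + 1) * ((s + 2) * (s + 3))) + n / (2 * ((s + 2) * (s + 3)))
        + (s + 1) / (2 * ((s + 2) * (s + 3))) := by
    rw [show (s : ℚ) + 2 + 1 = s + 3 by ring]
    field_simp
  have hs : (1 : ℚ) ≤ s := by exact_mod_cast hs1
  have h1 : (n : ℚ) / (2 * ((s + 2) * (s + 3))) ≤ n / 2 := by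
    gcongr
    nlinarith
  have h2 : ((s : ℚ) + 1) / (2 * ((s + 2) * (s + 3))) ≤ 1 := by
    rw [div_le_one (by positivity)]
    nlinarith
  have h3 : (n : ℚ) / (s + 1) ≤ n / 2 := by
    gcongr
    linarith
  rw [e]
  linarith

theorem le_coeff_seriesA {s : ℕ} (hs : 1 ≤ s) (n : ℕ) :
    (n : ℚ) ^ 2 / (2 * s * ((s + 2) * (s + 3))) - n - 1 ≤ coeff n (seriesA s) := by
  have h := le_coeff_geomX_mul (a := s + 2) (w := s) (by omega) hs n
  refine le_trans ?_ h
  push_cast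
  have hs1 : (1 : ℚ) ≤ s := by exact_mod_cast hs
  have h1 : (n : ℚ) / s ≤ n := div_le_self (by positivity) hs1
  rw [div_div, show (s : ℚ) + 2 + 1 = s + 3 by ring]
  linarith

theorem sq_div_growthK_le {s : ℕ} (hs : 1 ≤ s) (y : ℚ) :
    y ^ 2 / growthK s ≤ y ^ 2 / (2 * s * ((s + 2) * (s + 3)))
      - y ^ 2 / (2 * (s + 1) * ((s + 2) * (s + 3))) := by
  have hs1 : (1 : ℚ) ≤ s := by exact_mod_cast hs
  have e : y ^ 2 / (2 * s * ((s + 2) * (s + 3))) - y ^ 2 / (2 * (s + 1) * ((s + 2) * (s + 3))) =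
      y ^ 2 / (2 * ((s * (s + 1)) * ((s + 2) * (s + 3)))) := by
    field_simp
    ring
  rw [e, growthK]
  push_cast
  gcongr
  calc (s * (s + 1) * ((s + 2) * (s + 3)) : ℚ)
      ≤ ((s + 3) * (s + 3)) * ((s + 3) * (s + 3)) := by gcongr <;> linarith
    _ = ((s : ℚ) + 3) ^ 4 := by ring

theorem le_coeff_seriesA_sub_seriesB_shift {s : ℕ} (hs : 1 ≤ s) {m : ℕ} (hm : s ≤ m) :
    (m : ℚ) ^ 2 / growthK s - 4 * m - 4 ≤ coeff (m - s) (seriesA s) - coeff m (seriesB s) := by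
  have h1 := le_coeff_seriesA hs (m - s)
  have h2 := coeff_seriesB_le hs m
  have h3 := sq_div_growthK_le hs m
  rw [Nat.cast_sub hm] at h1
  have hs1 : (1 : ℚ) ≤ s := by exact_mod_cast hs
  have e : (m : ℚ) ^ 2 / (2 * s * ((s + 2) * (s + 3))) - m ≤
      ((m : ℚ) - s) ^ 2 / (2 * s * ((s + 2) * (s + 3))) := by
    rw [sub_le_iff_le_add, div_add' _ _ _ (by positivity)]
    gcongr
    have : (m : ℚ) * (2 * s) * 1 ≤ m * (2 * s) * ((s + 2) * (s + 3)) := by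
      gcongr
      nlinarith
    nlinarith [sq_nonneg (s : ℚ)]
  linarith

theorem le_coeff_seriesA_sub_seriesB_succ {s : ℕ} (hs : 1 ≤ s) (n : ℕ) :
    (n : ℚ) ^ 2 / growthK s - 4 * n - 4 ≤ coeff (n + 1) (seriesA s) - coeff n (seriesB s) := by
  have h1 := le_coeff_seriesA hs (n + 1)
  have h2 := coeff_seriesB_le hs n
  have h3 := sq_div_growthK_le hs n
  push_cast at h1
  have hs1 : (1 : ℚ) ≤ s := by exact_mod_cast hs
  have e : (n : ℚ) ^ 2 / (2 * s * ((s + 2) * (s + 3))) ≤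
      ((n : ℚ) + 1) ^ 2 / (2 * s * ((s + 2) * (s + 3))) := by
    gcongr
    linarith
  have : (0 : ℚ) ≤ n := by positivity
  linarith

/-- Holds because `(1 - X^(s+1)) - X(1 - X^s) = 1 - X`. -/
theorem coeff_succ_seriesC_sub {s : ℕ} (hs : 1 ≤ s) (n : ℕ) :
    coeff (n + 1) (seriesC s) - coeff n (seriesC s) =
      coeff (n + 1) (seriesA s) - coeff n (seriesB s) := by
  rw [← coeff_succ_X_mul n (seriesC s), ← coeff_succ_X_mul n (seriesB s), ← map_sub, ← map_sub,
    ← one_sub_mul_seriesC hs, ← one_sub_succ_mul_seriesC s]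
  congr 1
  ring

/-- The coefficients of `seriesC` are almost increasing. -/
theorem coeff_seriesC_sub_le {s : ℕ} (hs : 1 ≤ s) {i j : ℕ} (hij : i ≤ j) :
    coeff i (seriesC s) - 5 * growthK s * (4 * growthK s + 4) ≤ coeff j (seriesC s) := by
  have hK : (0 : ℚ) < growthK s := by rw [growthK]; positivity
  -- Increments are nonnegative from `5K` on, where `n²/K ≥ 5n ≥ 4n + 4`, and at least `-(4K+4)`
  -- before; the minimum bounds the number of possible losses.
  have key : coeff i (seriesC s) - (min j (5 * growthK s) : ℕ) * (4 * growthK s + 4) ≤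
      coeff j (seriesC s) := by
    induction j, hij using Nat.le_induction with
    | base =>
      have : (0 : ℚ) ≤ (min i (5 * growthK s) : ℕ) * (4 * growthK s + 4) := by positivity
      linarith
    | succ n _ ih =>
      have h1 := coeff_succ_seriesC_sub hs n
      have h2 := le_coeff_seriesA_sub_seriesB_succ hs n
      rcases lt_or_ge n (5 * growthK s) with h | h
      · have h3 := neg_le_of_quadratic_le hK h2
        rw [min_eq_left h.le] at ih
        rw [min_eq_left (by omega)]
        push_cast
        linarith
      · rw [min_eq_right h] at ih
        rw [min_eq_right (by omega)]
        have h4 : (5 : ℚ) * growthK s ≤ n := by exact_mod_cast h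
        have h6 : (5 : ℚ) * n ≤ (n : ℚ) ^ 2 / growthK s := by
          rw [le_div_iff₀ hK]
          nlinarith
        have h7 : (4 : ℚ) ≤ n := by
          have : (1 : ℚ) ≤ growthK s := by exact_mod_cast (by exact_mod_cast hK : 0 < growthK s)
          linarith
        linarith
  have h : ((min j (5 * growthK s) : ℕ) : ℚ) ≤ 5 * growthK s := by
    exact_mod_cast min_le_right _ _
  have : ((min j (5 * growthK s) : ℕ) : ℚ) * (4 * growthK s + 4) ≤
      5 * growthK s * (4 * growthK s + 4) := by gcongr
  linarith

/-! ### Lower bounds for the core series -/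

/-- A bound for the negative coefficients of the series with parts `s, s+1, s+2, s+3`. -/
@[irreducible] def deficit (s : ℕ) : ℕ := 4 * growthK s + 4 + 5 * growthK s * (4 * growthK s + 4)

/-- From this index on the coefficients of the series with parts `s, s+1, s+2, s+3` are large. -/
@[irreducible] def threshold (s : ℕ) : ℕ := growthK s * (2 * deficit s + 5)

/-- The main factor of `H_{L,s,k} - 1`, with parts `s, s+1, s+2, s+3`. -/
noncomputable def coreSeries (s k : ℕ) : ℚ⟦X⟧ :=
  (X ^ s * (1 - X ^ k) - (1 - X ^ s)) * seriesC s

theorem coeff_coreSeries {s : ℕ} (hs : 1 ≤ s) (k m : ℕ) :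
    coeff m (coreSeries s k) = (if s ≤ m then coeff (m - s) (seriesC s) else 0)
      - (if s + k ≤ m then coeff (m - (s + k)) (seriesC s) else 0) - coeff m (seriesB s) := by
  have e : coreSeries s k = X ^ s * seriesC s - X ^ (s + k) * seriesC s - seriesB s := by
    rw [coreSeries, ← one_sub_mul_seriesC hs]
    ring
  rw [e, map_sub, map_sub, coeff_X_pow_mul', coeff_X_pow_mul']

/-- Since `k ≥ s+1`, almost monotonicity replaces `C(m-s-k)` by `C(m-2s-1)`, and `C(m-s) - C(m-2s-1)
= A(m-s)`. -/
theorem le_coeff_coreSeries {s k : ℕ} (hs : 1 ≤ s) (hk : s + 1 ≤ k) {m : ℕ} (hm : 2 * s + 1 ≤ m) :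
    (m : ℚ) ^ 2 / growthK s - 4 * m - 4 - 5 * growthK s * (4 * growthK s + 4) ≤
      coeff m (coreSeries s k) := by
  have h1 := coeff_eq_of_one_sub_X_pow_mul (one_sub_succ_mul_seriesC s) (m - s)
  have h2 := le_coeff_seriesA_sub_seriesB_shift hs (show s ≤ m by omega)
  rw [if_pos (by omega)] at h1
  rw [coeff_coreSeries hs, if_pos (by omega), h1]
  split_ifs with h
  · have h3 := coeff_seriesC_sub_le hs (show m - (s + k) ≤ m - s - (s + 1) by omega)
    linarith
  · have h3 := nonnegCoeff_seriesC hs (m - s - (s + 1))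
    have : (0 : ℚ) ≤ 5 * growthK s * (4 * growthK s + 4) := by positivity
    linarith

theorem neg_deficit_le_coeff_coreSeries {s k : ℕ} (hs : 1 ≤ s) (hk : s + 1 ≤ k) (m : ℕ) :
    -(deficit s : ℚ) ≤ coeff m (coreSeries s k) := by
  have hK : (0 : ℚ) < growthK s := by rw [growthK]; positivity
  rcases le_or_gt (2 * s + 1) m with h | h
  · have h1 := le_coeff_coreSeries hs hk h
    have h2 := neg_le_of_quadratic_le hK (le_refl ((m : ℚ) ^ 2 / growthK s - 4 * m - 4))
    rw [deficit]
    push_cast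
    linarith
  -- For `m ≤ 2s < s + k` the term shifted by `s + k` is absent, so only `B(m)` is negative.
  · rw [coeff_coreSeries hs, if_neg (by omega : ¬ s + k ≤ m)]
    have h1 : 0 ≤ (if s ≤ m then coeff (m - s) (seriesC s) else 0) := by
      split_ifs
      · exact nonnegCoeff_seriesC hs _
      · exact le_rfl
    have h2 := coeff_seriesB_le hs m
    have h3 : (m : ℚ) ≤ 2 * s := by exact_mod_cast (by omega : m ≤ 2 * s)
    have h4 : (m : ℚ) ^ 2 / (2 * (s + 1) * ((s + 2) * (s + 3))) ≤ m := by
      rw [div_le_iff₀ (by positivity)]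
      rw [pow_two]
      gcongr
      have h7 : ((s : ℚ) + 1) * 6 ≤ (s + 1) * ((s + 2) * (s + 3)) := by
        gcongr
        nlinarith [(Nat.cast_nonneg s : (0 : ℚ) ≤ s)]
      linarith
    have h5 : (s : ℚ) ≤ growthK s := by
      rw [growthK]
      exact_mod_cast (by
        have := Nat.le_self_pow (show 4 ≠ 0 by norm_num) (s + 3)
        omega : s ≤ 2 * (s + 3) ^ 4)
    have h6 : (0 : ℚ) ≤ 5 * growthK s * (4 * growthK s + 4) := by positivity
    rw [deficit]
    push_cast
    linarith

theorem le_threshold (s : ℕ) : 2 * s + 1 ≤ threshold s := by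
  have h1 : s + 3 ≤ (s + 3) ^ 4 := Nat.le_self_pow (by norm_num) _
  have h2 : growthK s * 1 ≤ threshold s := by
    rw [threshold]; exact Nat.mul_le_mul_left _ (by omega)
  rw [growthK] at h2
  omega

theorem large_coeff_coreSeries {s k : ℕ} (hs : 1 ≤ s) (hk : s + 1 ≤ k) {m : ℕ}
    (hm : threshold s ≤ m) :
    2 * (deficit s : ℚ) * threshold s + 1 ≤ coeff m (coreSeries s k) := by
  have hK : (0 : ℚ) < growthK s := by rw [growthK]; positivity
  have h1 := le_coeff_coreSeries hs hk ((le_threshold s).trans hm)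
  have h2 : (threshold s : ℚ) ≤ m := by exact_mod_cast hm
  have h3 : (threshold s : ℚ) = growthK s * (2 * deficit s + 5) := by
    rw [threshold]
    push_cast
    ring
  -- Of the factor `2D + 5`, with `D` the deficit, `4m` absorbs the linear loss, `2Dm` gives the
  -- main term, and the last `m ≥ D + 1` pays for the constants.
  have h4 : (2 * (deficit s : ℚ) + 5) * m ≤ (m : ℚ) ^ 2 / growthK s := by
    rw [le_div_iff₀ hK]
    nlinarith [(Nat.cast_nonneg m : (0 : ℚ) ≤ m)]
  have h5 : (deficit s : ℚ) = 4 * growthK s + 4 + 5 * growthK s * (4 * growthK s + 4) := by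
    rw [deficit]
    push_cast
    ring
  have h6 : 2 * (deficit s : ℚ) * threshold s ≤ 2 * (deficit s : ℚ) * m := by gcongr
  have h7 : (1 : ℚ) ≤ growthK s := by exact_mod_cast (by exact_mod_cast hK : 0 < growthK s)
  have h8 : (deficit s : ℚ) + 1 ≤ threshold s := by
    have : (1 : ℚ) * (2 * deficit s + 5) ≤ growthK s * (2 * deficit s + 5) := by gcongr
    have : (0 : ℚ) ≤ deficit s := by positivity
    linarith
  linarith

/-! ### Convolution with the remaining parts -/

/-- Multiplying by a generating function of partitions keeps the coefficients from an explicit index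
on positive, whatever the additional parts are. -/
theorem coeff_coreSeries_mul_partsSeries_pos {s k : ℕ} (hs : 1 ≤ s) (hk : s + 1 ≤ k)
    {S : Finset ℕ} (hS : ∀ v ∈ S, 1 ≤ v) {N : ℕ} (hN : threshold s ^ 3 + threshold s ≤ N) :
    0 < coeff N (coreSeries s k * partsSeries S) := by
  have hw := nonnegCoeff_partsSeries hS
  have ht : 1 ≤ threshold s := le_trans (by omega) (le_threshold s)
  set T := threshold s
  set w : ℕ → ℚ := fun i => coeff i (partsSeries S) with hw_def
  set Ω : ℚ := ∑ i ∈ Finset.range (N - T + 1), w i with hΩ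
  have hΩ1 : 0 < Ω := by
    have h0 : w 0 = 1 := by
      simp only [hw_def, partsSeries, coeff_zero_eq_constantCoeff, map_prod]
      refine Finset.prod_eq_one fun v hv => ?_
      have h := congrArg constantCoeff (one_sub_mul_geomX (hS v hv))
      have hv0 : v ≠ 0 := by have := hS v hv; omega
      simpa [hv0] using h
    have h1 : w 0 ≤ Ω :=
      Finset.single_le_sum (f := w) (fun i _ => hw i) (Finset.mem_range.2 (by omega))
    linarith
  have hpart : ∀ m < T, w (N - m) ≤ 2 * Ω := by
    intro m hm
    have h1 := coeff_partsSeries_le hS ht (show T ^ 3 ≤ N - m by omega)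
    refine h1.trans ?_
    gcongr
    refine Finset.sum_le_sum_of_subset_of_nonneg (fun i hi => ?_) fun i _ _ => hw i
    rw [Finset.mem_range] at hi ⊢
    omega
  rw [coeff_mul, Finset.Nat.sum_antidiagonal_eq_sum_range_succ
    (fun i j => coeff i (coreSeries s k) * w j), Finset.range_eq_Ico,
    ← Finset.sum_Ico_consecutive _ (Nat.zero_le T) (by omega : T ≤ N + 1)]
  have hlow : -(2 * deficit s * T * Ω) ≤
      ∑ m ∈ Finset.Ico 0 T, coeff m (coreSeries s k) * w (N - m) := by
    have : ∑ m ∈ Finset.Ico 0 T, -(2 * deficit s * Ω) ≤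
        ∑ m ∈ Finset.Ico 0 T, coeff m (coreSeries s k) * w (N - m) := by
      refine Finset.sum_le_sum fun m hm => ?_
      have h1 := hpart m (Finset.mem_Ico.1 hm).2
      have h2 := neg_deficit_le_coeff_coreSeries hs hk m
      have h3 : 0 ≤ w (N - m) := hw _
      have h4 : (0 : ℚ) ≤ deficit s := by positivity
      nlinarith [mul_le_mul_of_nonneg_left h1 h4, mul_le_mul_of_nonneg_right h2 h3]
    refine le_trans (le_of_eq ?_) this
    rw [Finset.sum_const, Nat.card_Ico, nsmul_eq_mul, Nat.sub_zero]
    ring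
  have hhigh : (2 * deficit s * T + 1) * Ω ≤
      ∑ m ∈ Finset.Ico T (N + 1), coeff m (coreSeries s k) * w (N - m) := by
    have e : Ω = ∑ m ∈ Finset.Ico T (N + 1), w (N - m) := by
      rw [Finset.sum_Ico_reflect w T le_rfl, hΩ, Finset.range_eq_Ico]
      congr 2
      · omega
      · omega
    rw [e, Finset.mul_sum]
    refine Finset.sum_le_sum fun m hm => ?_
    exact mul_le_mul_of_nonneg_right (large_coeff_coreSeries hs hk (Finset.mem_Ico.1 hm).1) (hw _)
  linarith

/-! ### Comparison with the stated bound -/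

/-- The threshold is polynomial in `s`, so crude powers suffice: `T³ + T ≤ K^13 ≤ (s+3)^65`, while
`P ≥ s+3` occurs in `Γ(s)` with exponent at least 65. -/
theorem threshold_bound_le_GammaBound {s : ℕ} (hs : 1 ≤ s) :
    threshold s ^ 3 + threshold s ≤ GammaBound s := by
  set x := s + 3 with hx
  have hx4 : 4 ≤ x := by omega
  have hK1 : 512 ≤ growthK s := by
    have : 4 ^ 4 ≤ (s + 3) ^ 4 := Nat.pow_le_pow_left (by omega) 4
    rw [growthK]
    omega
  have hK2 : growthK s ≤ x ^ 5 := by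
    rw [growthK, pow_succ x 4, mul_comm 2]
    exact Nat.mul_le_mul_left _ (by omega)
  set K := growthK s with hKdef
  have hC : 2 * deficit s + 5 ≤ K ^ 3 := by
    rw [deficit, ← hKdef]
    have h1 : 512 * K ^ 2 ≤ K ^ 3 := by
      rw [pow_succ K 2, mul_comm]; exact Nat.mul_le_mul_left _ hK1
    nlinarith
  have hT : threshold s ≤ K ^ 4 := by
    rw [threshold, ← hKdef, pow_succ K 3, mul_comm]
    exact Nat.mul_le_mul_right _ hC
  have hT2 : threshold s ^ 3 + threshold s ≤ K ^ 13 := by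
    have h1 : threshold s ^ 3 ≤ (K ^ 4) ^ 3 := Nat.pow_le_pow_left hT 3
    have h2 : K ^ 4 ≤ K ^ 12 := Nat.pow_le_pow_right (by omega) (by norm_num)
    have h3 : K ^ 12 * 2 ≤ K ^ 13 := by
      rw [pow_succ K 12]; exact Nat.mul_le_mul_left _ (by omega)
    rw [← pow_mul] at h1
    norm_num at h1
    omega
  have hT3 : K ^ 13 ≤ x ^ 65 := by
    calc K ^ 13 ≤ (x ^ 5) ^ 13 := Nat.pow_le_pow_left hK2 13
      _ = x ^ 65 := by rw [← pow_mul]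
  set L := 3 * s + 2 with hL
  set P := prodP L s with hP
  have hPL : s + L ≤ P :=
    Finset.single_le_prod' (f := fun i => s + i) (fun i hi => by
      have := (Finset.mem_Icc.1 hi).1
      omega) (Finset.mem_Icc.2 ⟨by omega, le_rfl⟩)
  have hPx : x ≤ P := by omega
  have hexp : 65 ≤ (P ^ 2 - 1) * L + 2 := by
    have h1 : 6 ^ 2 ≤ P ^ 2 := Nat.pow_le_pow_left (by omega) 2
    have h2 : 35 * 5 ≤ (P ^ 2 - 1) * L := Nat.mul_le_mul (by omega) (by omega)
    omega
  have hpow : x ^ 65 ≤ P ^ ((P ^ 2 - 1) * L + 2) :=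
    (Nat.pow_le_pow_left hPx 65).trans (Nat.pow_le_pow_right (by omega) hexp)
  have hsum : 1 ≤ ∑ i ∈ Finset.Icc 1 L, (s + i) :=
    le_trans (by omega : 1 ≤ s + 1) (Finset.single_le_sum (f := fun i => s + i)
      (fun i _ => Nat.zero_le _) (Finset.mem_Icc.2 ⟨le_rfl, by omega⟩))
  calc threshold s ^ 3 + threshold s ≤ P ^ ((P ^ 2 - 1) * L + 2) := hT2.trans (hT3.trans hpow)
    _ ≤ P ^ ((P ^ 2 - 1) * L + 2) + ((P ^ 2 - 1) * L - 2) * P := Nat.le_add_right _ _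
    _ ≤ GammaBound s := by
      rw [GammaBound, gammaLS, ← hL, ← hP]
      exact Nat.le_mul_of_pos_left _ hsum

/-! ### Factorization of `H` and conclusion -/

theorem qPochhammer_X_pow_mul_prod_geomX {a : ℕ} (ha : 1 ≤ a) (n : ℕ) :
    qPochhammer ((X : ℚ⟦X⟧) ^ a) X n * ∏ i ∈ Finset.range n, geomX (a + i) = 1 := by
  rw [qPochhammer, ← Finset.prod_mul_distrib]
  refine Finset.prod_eq_one fun i _ => ?_
  rw [← pow_add, one_sub_mul_geomX (by omega)]

theorem inv_qPochhammer_X_pow {a : ℕ} (ha : 1 ≤ a) (n : ℕ) :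
    (qPochhammer ((X : ℚ⟦X⟧) ^ a) X n)⁻¹ = ∏ i ∈ Finset.range n, geomX (a + i) := by
  rw [PowerSeries.inv_eq_iff_mul_eq_one (by rw [constantCoeff_qPochhammer_X_pow a n ha]; norm_num),
    mul_comm, qPochhammer_X_pow_mul_prod_geomX ha]

theorem seriesH_eq {L s : ℕ} (hL : 3 ≤ L) (hs : 1 ≤ s) (k : ℕ) :
    seriesH L s k =
      coreSeries s k * partsSeries ((Finset.range (L - 3)).image (fun i => s + 4 + i)) + 1 := by
  obtain ⟨n, rfl⟩ := Nat.exists_eq_add_of_le hL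
  have h1 := one_sub_mul_geomX hs
  have e1 : ∏ i ∈ Finset.range (3 + n + 1), geomX (s + i) =
      geomX s * (geomX (s + 1) * geomX (s + 2) * geomX (s + 3) *
        ∏ i ∈ Finset.range n, geomX (s + 4 + i)) := by
    rw [show 3 + n + 1 = 4 + n by ring, Finset.prod_range_add]
    simp only [Finset.prod_range_succ, Finset.prod_range_zero, ← add_assoc, add_zero]
    ring
  have e2 : ∏ i ∈ Finset.range (3 + n), geomX (s + 1 + i) =
      geomX (s + 1) * geomX (s + 2) * geomX (s + 3) *
        ∏ i ∈ Finset.range n, geomX (s + 4 + i) := by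
    rw [Finset.prod_range_add]
    simp only [Finset.prod_range_succ, Finset.prod_range_zero, ← add_assoc, add_zero, one_mul]
  rw [seriesH, inv_qPochhammer_X_pow hs, inv_qPochhammer_X_pow (by omega), partsSeries,
    Finset.prod_image (fun i _ j _ h => by simpa using h), Nat.add_sub_cancel_left, e1, e2,
    coreSeries, seriesC, seriesB, show s + 2 + 1 = s + 3 from rfl]
  set W := ∏ i ∈ Finset.range n, geomX (s + 4 + i)
  linear_combination (geomX (s + 1) * geomX (s + 2) * geomX (s + 3) * W) * h1

theorem mainTheorem1 (L s k : ℕ) (hL : 3 ≤ L) (hs : 1 ≤ s) (hk : s + 1 ≤ k)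
    (N : ℕ) (hN : GammaBound s ≤ N) :
    0 < PowerSeries.coeff N (seriesH L s k) := by
  have hT := (threshold_bound_le_GammaBound hs).trans hN
  have h1 := coeff_coreSeries_mul_partsSeries_pos hs hk
    (S := (Finset.range (L - 3)).image (fun i => s + 4 + i)) (fun v hv => by
      obtain ⟨i, _, rfl⟩ := Finset.mem_image.1 hv
      omega) hT
  rw [seriesH_eq hL hs, map_add]
  exact add_pos_of_pos_of_nonneg h1 (NonnegCoeff.one N)
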